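/- Let $k\ge 1$ be an integer, let $p=2k^2+2k+1$, and let $m,n$ be integers with $m>2p$ and $n>2p$. Let $G_{m,n}$ be the $m\times n$ grid graph, i.e. the graph with vertex set $\{0,\dots,m-1\}\times\{0,\dots,n-1\}$ in which two vertices are adjacent if and only if they agree in one coordinate and differ by exactly $1$ in the other. A set $S$ of vertices of a graph is called $k$-distance dominating if every vertex is in $S$ or is at graph distance at most $k$ from some vertex of $S$, and the $k$-distance domination number $\gamma_k$ of a finite graph is the smallest cardinality of a $k$-distance dominating set. Then $$\gamma_k(G_{m,n})\;\le\;\left\lfloor\frac{(m+2k)(n+2k)}{p}\right\rfloor-4 .$$ This improves the Fata–Smith–Sundaram bound $\gamma_k(G_{m,n})\le\left\lceil\frac{(m+2k)(n+2k)}{p}+\frac p4\right\rceil$, in the sense that $$\left\lfloor\frac{(m+2k)(n+2k)}{p}\right\rfloor-4\;<\;\left\lceil\frac{(m+2k)(n+2k)}{p}+\frac p4\right\rceil .$$ -/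

import Mathlib

/-- `S` is a `k`-distance dominating set of `G`: every vertex is in `S` or at distance at most `k`
from some vertex of `S`. The extended distance is used, so that vertices in different connected
components are at distance `⊤` (and not at distance `0`). -/
def IsDistDominating {V : Type*} (G : SimpleGraph V) (k : ℕ) (S : Finset V) : Prop :=
  ∀ v : V, v ∈ S ∨ ∃ w ∈ S, G.edist v w ≤ (k : ℕ∞)

/-- The `k`-distance domination number of a finite graph `G`: the smallest cardinality of a
`k`-distance dominating set of `G`. -/
noncomputable def distDominationNumber {V : Type*} [Finite V] (G : SimpleGraph V) (k : ℕ) : ℕ :=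
  sInf {c : ℕ | ∃ S : Finset V, IsDistDominating G k S ∧ S.card = c}

/-- The `m × n` grid graph: the Cartesian product of the paths on `m` and on `n` vertices. -/
def gridGraph (m n : ℕ) : SimpleGraph (Fin m × Fin n) :=
  (SimpleGraph.pathGraph m).boxProd (SimpleGraph.pathGraph n)

/-- The minimum in the definition of the `k`-distance domination number is attained. -/
theorem exists_isDistDominating_card_eq {V : Type*} [Finite V] (G : SimpleGraph V) (k : ℕ) :
    ∃ S : Finset V, IsDistDominating G k S ∧ S.card = distDominationNumber G k := by
  have : Fintype V := Fintype.ofFinite V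
  exact Nat.sInf_mem (s := {c : ℕ | ∃ S : Finset V, IsDistDominating G k S ∧ S.card = c})
    ⟨_, Finset.univ, fun v => Or.inl (Finset.mem_univ v), rfl⟩

/-!
The integer points `c` with `(k + 1) x + k y ≡ l` modulo `p = 2 k ^ 2 + 2 k + 1` form a perfect
code: the taxicab balls of radius `k` around them tile `ℤ²`. Only balls with centre in the
rectangle enlarged by `k` on each side meet the grid, and moving such a centre to the nearest grid
point loses no coverage. Averaging over `l` gives a dominating set of at most `(m + 2 k) (n + 2 k)
/ p` points, so it remains to save one centre at each corner.

The saving rests on the shift principle `exists_shifted_center`: the centres `c` on or below a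
level line of the form `(k + 1) x + k y` cut off a corner, and they can be translated by any
vector `w` on which the form is nonnegative without opening a gap along that line. New gaps can
appear only at the two sides of the quadrant. Two translations are used. The first is `w = (0,
1)`, with the level line through a centre `(-k, y₀)`. Of the quadrant this centre covers only `(0,
y₀)`, which after the translation is covered by other centres; a gap arises only at `(x, 0)` for a
centre `(x, -k - 1)` that enters the enlarged quadrant from below (`covered_by_shift_up`). The
second is `w = (1, -1)`, with the level line through a centre `(x, -k)`, which leaves the enlarged
quadrant; a gap arises only if a centre `(-k - 1, y)` enters it from the left
(`exists_cornerSaving_of_slide`). For each residue `l`, either one of the translations opens no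
gap, or the only gap `(x, 0)` can be closed by a centre outside the quadrant, which has some
freedom to move, or a centre in the corner square covers nothing (`exists_cornerSaving`).

The codes are invariant under quarter turns, so the same saving is available at all four corners.
Measured from the corner, the centres involved have coordinates at most `p`, and `m, n > 2 p`
keeps the four modifications disjoint (`exists_cover_rectangle`).
-/

/-! ### Perfect codes in the plane -/

/-- The integer linear form `(k + 1) x + k y`. Modulo `2 k ^ 2 + 2 k + 1` its fibres are the
perfect codes of the grid, and over the integers its level lines cut off the corners. -/
def gridForm (k : ℤ) (z : ℤ × ℤ) : ℤ := (k + 1) * z.1 + k * z.2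

/-- The size `2 k ^ 2 + 2 k + 1` of a ball of radius `k` in `ℤ²` with the taxicab distance. -/
def ballSize (k : ℤ) : ℤ := 2 * k ^ 2 + 2 * k + 1

/-- The taxicab distance on `ℤ²`. -/
def taxi (z c : ℤ × ℤ) : ℤ := |z.1 - c.1| + |z.2 - c.2|

/-- The point `c` lies in the perfect code of `ℤ²` with residue `l`. -/
def InCode (k l : ℤ) (c : ℤ × ℤ) : Prop := ballSize k ∣ gridForm k c - l

theorem taxi_le_iff {z c : ℤ × ℤ} {k : ℤ} :
    taxi z c ≤ k ↔ z.1 - c.1 + (z.2 - c.2) ≤ k ∧ z.1 - c.1 - (z.2 - c.2) ≤ k ∧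
      c.1 - z.1 + (z.2 - c.2) ≤ k ∧ c.1 - z.1 - (z.2 - c.2) ≤ k := by
  unfold taxi
  constructor
  · intro h
    have h1 := le_abs_self (z.1 - c.1)
    have h2 := neg_abs_le (z.1 - c.1)
    have h3 := le_abs_self (z.2 - c.2)
    have h4 := neg_abs_le (z.2 - c.2)
    omega
  · rintro ⟨h1, h2, h3, h4⟩
    rcases abs_cases (z.1 - c.1) with h | h <;> rcases abs_cases (z.2 - c.2) with h' | h' <;> omega

theorem ballSize_pos {k : ℤ} (hk : 1 ≤ k) : 0 < ballSize k := by
  unfold ballSize; positivity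

theorem gridForm_le_of_taxi_le {k : ℤ} (hk : 1 ≤ k) {z c : ℤ × ℤ} (h : taxi z c ≤ k) :
    gridForm k z ≤ gridForm k c + k * (k + 1) := by
  obtain ⟨h1, h2, -, -⟩ := taxi_le_iff.1 h
  unfold gridForm
  -- `2 (k + 1) a + 2 k b = (2 k + 1) (a + b) + (a - b)`
  nlinarith

theorem taxi_comm (z c : ℤ × ℤ) : taxi z c = taxi c z := by
  unfold taxi
  rw [abs_sub_comm z.1, abs_sub_comm z.2]

/-- The codes are covering: a ball of radius `k` meets every residue class. On the ball the form
takes each value `r` with `|r| ≤ k (k + 1)`; the sum of the coordinates of the solution is the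
integer nearest to `2 r / (2 k + 1)`. -/
theorem exists_inCode_taxi_le {k : ℤ} (hk : 1 ≤ k) (l : ℤ) (z : ℤ × ℤ) :
    ∃ c, InCode k l c ∧ taxi z c ≤ k := by
  obtain ⟨r, j, hr, hlo, hhi⟩ : ∃ r j, l - gridForm k z = r + ballSize k * j ∧
      -(k * (k + 1)) ≤ r ∧ r ≤ k * (k + 1) := by
    have hp := ballSize_pos hk
    have h0 := Int.emod_add_mul_ediv (l - gridForm k z + k * (k + 1)) (ballSize k)
    have h1 := Int.emod_nonneg (l - gridForm k z + k * (k + 1)) hp.ne'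
    have h2 := Int.emod_lt_of_pos (l - gridForm k z + k * (k + 1)) hp
    refine ⟨(l - gridForm k z + k * (k + 1)) % ballSize k - k * (k + 1),
      (l - gridForm k z + k * (k + 1)) / ballSize k, ?_, ?_, ?_⟩
    · linarith
    · linarith
    · unfold ballSize at *
      linarith
  have h0 := Int.emod_add_mul_ediv (2 * r + k) (2 * k + 1)
  have h1 := Int.emod_nonneg (2 * r + k) (show 2 * k + 1 ≠ 0 by omega)
  have h2 := Int.emod_lt_of_pos (2 * r + k) (show 0 < 2 * k + 1 by omega)
  generalize (2 * r + k) / (2 * k + 1) = s at *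
  have hs1 : s < k + 1 := by
    by_contra! h
    nlinarith
  have hs2 : -k - 1 < s := by
    by_contra! h
    nlinarith
  refine ⟨(z.1 + (r - k * s), z.2 + (s - (r - k * s))), ⟨-j, ?_⟩, taxi_le_iff.2 ?_⟩
  · have : gridForm k z = (k + 1) * z.1 + k * z.2 := rfl
    simp only [gridForm]
    linear_combination -this - hr
  · have : (2 * k + 1) * s = 2 * (k * s) + s := by ring
    refine ⟨?_, ?_, ?_, ?_⟩ <;> dsimp only <;> linarith

/-! ### Translating a part of a code -/

theorem InCode.add_of_dvd {k l : ℤ} {c v : ℤ × ℤ} (h : InCode k l c)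
    (hv : ballSize k ∣ gridForm k v) : InCode k l (c + v) := by
  have : gridForm k (c + v) - l = (gridForm k c - l) + gridForm k v := by
    simp only [gridForm, Prod.fst_add, Prod.snd_add]; ring
  unfold InCode
  rw [this]
  exact dvd_add h hv

/-- The shift principle. If the part `gridForm ≤ F` of the code is translated by a vector on which
the form is nonnegative, then every point covered by that part stays covered by its translate:
a centre beyond the level line `F` lies on a level at least `F + p`, which is too far. -/
theorem exists_shifted_center {k l F : ℤ} (hk : 1 ≤ k) (hF : ballSize k ∣ F - l) {w z c : ℤ × ℤ}
    (hw : 0 ≤ gridForm k w) (hcF : gridForm k c ≤ F) (hzc : taxi z c ≤ k) :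
    ∃ c', InCode k l c' ∧ gridForm k c' ≤ F ∧ taxi (z - w) c' ≤ k := by
  obtain ⟨c', hc', hd⟩ := exists_inCode_taxi_le hk l (z - w)
  refine ⟨c', hc', ?_, hd⟩
  by_contra! hlt
  have hstep : F + ballSize k ≤ gridForm k c' := by
    obtain ⟨i, hi⟩ : ballSize k ∣ gridForm k c' - F := by
      have := dvd_sub hc' hF
      rwa [sub_sub_sub_cancel_right] at this
    have hi0 : 0 < i := by
      have := ballSize_pos hk
      by_contra! h
      nlinarith
    nlinarith [ballSize_pos hk]
  have h1 := gridForm_le_of_taxi_le hk hzc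
  have h2 := gridForm_le_of_taxi_le hk (taxi_comm (z - w) c' ▸ hd)
  have h3 : gridForm k (z - w) = gridForm k z - gridForm k w := by
    simp only [gridForm, Prod.fst_sub, Prod.snd_sub]; ring
  unfold ballSize at hstep
  linarith

theorem InCode.dvd_sub_fst {k l x x' y : ℤ} (h : InCode k l (x, y)) (h' : InCode k l (x', y)) :
    ballSize k ∣ x - x' := by
  obtain ⟨i, hi⟩ := h
  obtain ⟨j, hj⟩ := h'
  -- `-2 k` is an inverse of `k + 1`
  refine ⟨x - x' - 2 * k * (i - j), ?_⟩
  simp only [gridForm, ballSize] at *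
  linear_combination (-2 * k) * (hi - hj)

theorem InCode.dvd_sub_snd {k l x y y' : ℤ} (h : InCode k l (x, y)) (h' : InCode k l (x, y')) :
    ballSize k ∣ y - y' := by
  obtain ⟨i, hi⟩ := h
  obtain ⟨j, hj⟩ := h'
  -- `-2 (k + 1)` is an inverse of `k`
  refine ⟨y - y' - 2 * (k + 1) * (i - j), ?_⟩
  simp only [gridForm, ballSize] at *
  linear_combination (-2 * (k + 1)) * (hi - hj)

theorem le_of_dvd_sub_of_lt {p x y : ℤ} (h : p ∣ x - y) (hlt : y < x + p) : y ≤ x := by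
  by_contra! hxy
  have := Int.le_of_dvd (sub_pos.2 hxy) ((dvd_sub_comm).1 h)
  omega

/-! ### The saving at a corner -/

/-- Some centre of the code lies in the left column `x = -k` of the enlarged quadrant, at a height
between `1` and `p`. -/
theorem exists_inCode_left {k : ℤ} (hk : 1 ≤ k) (l : ℤ) :
    ∃ y, 1 ≤ y ∧ y ≤ ballSize k ∧ InCode k l (-k, y) := by
  have hp := ballSize_pos hk
  set a := -2 * (k + 1) * (l + k * (k + 1)) - 1 with ha
  refine ⟨a % ballSize k + 1, ?_, ?_, ?_⟩
  · have := Int.emod_nonneg a hp.ne'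
    omega
  · have := Int.emod_lt_of_pos a hp
    omega
  · have h0 := Int.emod_add_mul_ediv a (ballSize k)
    generalize a % ballSize k = r at *
    generalize a / ballSize k = i at *
    refine ⟨-(l + k * (k + 1)) - k * i, ?_⟩
    rw [ha] at h0
    simp only [gridForm, ballSize] at *
    linear_combination k * h0

open Classical in
/-- The centres in the corner of the enlarged quadrant `x, y ≥ -k` cut off by the level line `F`. -/
noncomputable def cornerPart (k l F : ℤ) : Finset (ℤ × ℤ) :=
  {c ∈ Finset.Icc (-k) (ballSize k - 1) ×ˢ Finset.Icc (-k) (ballSize k) |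
    InCode k l c ∧ gridForm k c ≤ F}

theorem mem_cornerPart {k l F : ℤ} (hk : 1 ≤ k) (hF : F ≤ k * (ballSize k - k - 1))
    {c : ℤ × ℤ} : c ∈ cornerPart k l F ↔
      InCode k l c ∧ gridForm k c ≤ F ∧ -k ≤ c.1 ∧ -k ≤ c.2 := by
  simp only [cornerPart, Finset.mem_filter, Finset.mem_product, Finset.mem_Icc]
  constructor
  · rintro ⟨⟨⟨h1, -⟩, h2, -⟩, h3, h4⟩
    exact ⟨h3, h4, h1, h2⟩
  · rintro ⟨h3, h4, h1, h2⟩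
    refine ⟨⟨⟨h1, ?_⟩, h2, ?_⟩, h3, h4⟩
    all_goals
      simp only [gridForm, ballSize] at *
      by_contra! h
      nlinarith

/-- The saving at a corner: `T` is a set of centres near the corner of the enlarged quadrant, and
the smaller set `M` covers all points of the quadrant `x, y ≥ 0` that `T` covers. The bounds on `T`
are asymmetric, so that the sets at adjacent corners of a rectangle are disjoint. -/
def CornerSaving (k l : ℤ) (T M : Finset (ℤ × ℤ)) : Prop :=
  M.card + 1 ≤ T.card ∧
  (∀ c ∈ T, InCode k l c ∧ -k ≤ c.1 ∧ c.1 < ballSize k ∧ -k ≤ c.2 ∧ c.2 ≤ ballSize k) ∧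
  ∀ z : ℤ × ℤ, 0 ≤ z.1 → 0 ≤ z.2 → (∃ c ∈ T, taxi z c ≤ k) → ∃ c ∈ M, taxi z c ≤ k

theorem bounds_of_mem_cornerPart {k l F : ℤ} {c : ℤ × ℤ} (h : c ∈ cornerPart k l F) :
    InCode k l c ∧ -k ≤ c.1 ∧ c.1 < ballSize k ∧ -k ≤ c.2 ∧ c.2 ≤ ballSize k := by
  simp only [cornerPart, Finset.mem_filter, Finset.mem_product, Finset.mem_Icc] at h
  obtain ⟨⟨⟨h1, h2⟩, h3, h4⟩, h5, -⟩ := h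
  exact ⟨h5, h1, by omega, h3, h4⟩

theorem card_image_erase_add_one_le {T : Finset (ℤ × ℤ)} {a : ℤ × ℤ} (ha : a ∈ T)
    (g : ℤ × ℤ → ℤ × ℤ) : ((T.erase a).image g).card + 1 ≤ T.card := by
  have := Finset.card_erase_add_one ha
  have := Finset.card_image_le (s := T.erase a) (f := g)
  omega

/-- Translation of the corner part by `(0, 1)`, without the topmost centre `(-k, y₀)`: coverage can
be lost only at a point `(x, 0)` above a centre `(x, -k - 1)` outside the enlarged quadrant. -/
theorem covered_by_shift_up {k l y₀ : ℤ} (hk : 1 ≤ k) (hy : y₀ ≤ ballSize k)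
    (hA : InCode k l (-k, y₀)) {z : ℤ × ℤ} (hz1 : 0 ≤ z.1) (hz2 : 0 ≤ z.2)
    (hz : ∃ c ∈ cornerPart k l (k * (y₀ - k - 1)), taxi z c ≤ k) :
    (∃ c ∈ (cornerPart k l (k * (y₀ - k - 1))).erase (-k, y₀), taxi z (c + (0, 1)) ≤ k) ∨
      (z.2 = 0 ∧ InCode k l (z.1, -k - 1) ∧ gridForm k (z.1, -k - 1) ≤ k * (y₀ - k - 1)) := by
  have hF : k * (y₀ - k - 1) ≤ k * (ballSize k - k - 1) := by nlinarith
  have hFA : gridForm k (-k, y₀) = k * (y₀ - k - 1) := by simp only [gridForm]; ring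
  obtain ⟨c, hc, hzc⟩ := hz
  obtain ⟨hcC, hcF, -, -⟩ := (mem_cornerPart hk hF).1 hc
  obtain ⟨c', hc'C, hc'F, hd⟩ := exists_shifted_center (F := k * (y₀ - k - 1)) (w := (0, 1)) hk
    (by rw [← hFA]; exact hA) (by simp only [gridForm]; linarith) hcF hzc
  obtain ⟨h1, h2, h3, h4⟩ := taxi_le_iff.1 hd
  simp only [Prod.fst_sub, Prod.snd_sub] at h1 h2 h3 h4
  rcases lt_or_ge c'.2 (-k) with hlt | hge
  · right
    have e1 : c'.1 = z.1 := by omega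
    have e2 : c'.2 = -k - 1 := by omega
    have e : c' = (z.1, -k - 1) := Prod.ext e1 e2
    rw [e] at hc'C hc'F
    exact ⟨by omega, hc'C, hc'F⟩
  · left
    refine ⟨c', Finset.mem_erase.2 ⟨?_, (mem_cornerPart hk hF).2 ⟨hc'C, hc'F, by omega, hge⟩⟩, ?_⟩
    · -- the ball around `(-k, y₀ + 1)` has only `(0, y₀ + 1)` in the quadrant, and this point is
      -- too high for the level line
      rintro rfl
      dsimp only at h1 h2 h3 h4
      have e1 : z.1 = 0 := by omega
      have e2 : z.2 = y₀ + 1 := by omega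
      have := gridForm_le_of_taxi_le hk hzc
      simp only [gridForm, e1, e2] at this hcF
      nlinarith
    · refine taxi_le_iff.2 ?_
      simp only [Prod.fst_add, Prod.snd_add]
      omega

theorem left_mem_cornerPart {k l y₀ : ℤ} (hk : 1 ≤ k) (h1 : 1 ≤ y₀) (hy : y₀ ≤ ballSize k)
    (hA : InCode k l (-k, y₀)) : (-k, y₀) ∈ cornerPart k l (k * (y₀ - k - 1)) := by
  refine (mem_cornerPart hk (by nlinarith)).2 ⟨hA, ?_, le_rfl, ?_⟩
  · simp only [gridForm]
    nlinarith
  · dsimp only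
    omega

/-- The saving when no centre enters the enlarged quadrant from below. -/
theorem exists_cornerSaving_of_no_entry {k l y₀ : ℤ} (hk : 1 ≤ k) (h1 : 1 ≤ y₀)
    (hy : y₀ ≤ ballSize k) (hA : InCode k l (-k, y₀))
    (hno : ∀ x, 0 ≤ x → InCode k l (x, -k - 1) → k * (y₀ - k - 1) < gridForm k (x, -k - 1)) :
    ∃ T M, CornerSaving k l T M := by
  refine ⟨cornerPart k l (k * (y₀ - k - 1)),
    ((cornerPart k l (k * (y₀ - k - 1))).erase (-k, y₀)).image (· + (0, 1)),
    card_image_erase_add_one_le (left_mem_cornerPart hk h1 hy hA) _,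
    fun c hc => bounds_of_mem_cornerPart hc, fun z hz1 hz2 hz => ?_⟩
  rcases covered_by_shift_up hk hy hA hz1 hz2 hz with ⟨c, hc, hd⟩ | ⟨-, hC, hF⟩
  · exact ⟨_, Finset.mem_image_of_mem _ hc, hd⟩
  · exact absurd hF (not_le.2 (hno _ hz1 hC))

/-- The saving when the centre that enters from below is `(k q, -k - 1)`, on the level line through
the topmost centre. The uncovered point `(k q, 0)` is taken over by the centre
`(k q + k + 1, -1)`, which can be moved to `(k q + k, 0)` since it lies outside the quadrant. -/
theorem exists_cornerSaving_of_entry_on_line {k l q : ℤ} (hk : 1 ≤ k) (h1 : 1 ≤ q)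
    (hq : q ≤ 2 * k) (hA : InCode k l (-k, (k + 1) * q)) :
    ∃ T M, CornerSaving k l T M := by
  have hpk : ballSize k = 2 * k ^ 2 + 2 * k + 1 := rfl
  have hy1 : 1 ≤ (k + 1) * q := by nlinarith
  have hy : (k + 1) * q ≤ ballSize k := by rw [hpk]; nlinarith
  have hX : InCode k l (k * q, -k - 1) := by
    have : gridForm k (k * q, -k - 1) = gridForm k (-k, (k + 1) * q) := by
      simp only [gridForm]; ring
    rw [InCode, this]
    exact hA
  have hkq : k * q ≤ 2 * k ^ 2 := by nlinarith
  have hkq0 : 0 < k * q := by positivity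
  set T₀ := cornerPart k l (k * ((k + 1) * q - k - 1)) with hT₀
  have hDT : (k * q + k + 1, -1) ∉ T₀ := by
    intro h
    have h2 := ((mem_cornerPart hk (by nlinarith)).1 h).2.1
    simp only [gridForm] at h2
    nlinarith
  have hcard : ((T₀.erase (-k, (k + 1) * q)).image (· + (0, 1))).card + 1 ≤ T₀.card :=
    card_image_erase_add_one_le (left_mem_cornerPart hk hy1 hy hA) _
  refine ⟨insert (k * q + k + 1, -1) T₀,
    insert (k * q + k, 0) ((T₀.erase (-k, (k + 1) * q)).image (· + (0, 1))), ?_, ?_, ?_⟩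
  · rw [Finset.card_insert_of_notMem hDT]
    have := Finset.card_insert_le ((k * q + k, 0) : ℤ × ℤ)
      ((T₀.erase (-k, (k + 1) * q)).image (· + (0, 1)))
    omega
  · intro c hc
    rcases Finset.mem_insert.1 hc with rfl | hc
    · refine ⟨?_, ?_, ?_, ?_, ?_⟩
      · have := hX.add_of_dvd (v := (k + 1, k))
          ⟨1, by simp only [gridForm, ballSize]; ring⟩
        convert this using 1
        ext <;> simp only [Prod.fst_add, Prod.snd_add] <;> ring
      all_goals dsimp only; nlinarith
    · exact bounds_of_mem_cornerPart hc
  · rintro z hz1 hz2 ⟨c, hc, hzc⟩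
    rcases Finset.mem_insert.1 hc with rfl | hc
    · refine ⟨_, Finset.mem_insert_self _ _, ?_⟩
      rw [taxi_le_iff] at hzc ⊢
      dsimp only at *
      omega
    · rcases covered_by_shift_up hk hy hA hz1 hz2 ⟨c, hc, hzc⟩ with ⟨c, hc, hd⟩ | ⟨hz0, hC, hF⟩
      · exact ⟨_, Finset.mem_insert_of_mem (Finset.mem_image_of_mem _ hc), hd⟩
      · have hle : k * q ≤ z.1 := le_of_dvd_sub_of_lt (hC.dvd_sub_fst hX) (by rw [hpk]; omega)
        have hge : z.1 ≤ k * q := by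
          simp only [gridForm] at hF
          by_contra! h
          nlinarith
        refine ⟨_, Finset.mem_insert_self _ _, ?_⟩
        rw [taxi_le_iff]
        dsimp only
        omega

/-- The saving when the centre that enters from below is `(t, -k - 1)` with `t < k`. The uncovered
point `(t, 0)` is taken over by the centre `(t - k, 0)`, which may be moved to `(0, 1)`. -/
theorem exists_cornerSaving_of_entry_lt {k l y₀ t : ℤ} (hk : 1 ≤ k) (h1 : 1 ≤ y₀)
    (hy : y₀ ≤ ballSize k) (hA : InCode k l (-k, y₀)) (ht0 : 0 ≤ t) (htk : t < k)
    (hX : InCode k l (t, -k - 1)) (hF : gridForm k (t, -k - 1) ≤ k * (y₀ - k - 1)) :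
    ∃ T M, CornerSaving k l T M := by
  have hpk : ballSize k = 2 * k ^ 2 + 2 * k + 1 := rfl
  set T := cornerPart k l (k * (y₀ - k - 1)) with hT
  have hgrid : gridForm k (t - k, 0) = gridForm k (t, -k - 1) := by
    simp only [gridForm]; ring
  have hc : (t - k, 0) ∈ T.erase (-k, y₀) := by
    refine Finset.mem_erase.2 ⟨?_, (mem_cornerPart hk (by nlinarith)).2 ⟨?_, ?_, ?_, ?_⟩⟩
    · intro h
      have := congrArg Prod.snd h
      dsimp only at this
      omega
    · rw [InCode, hgrid]
      exact hX
    · rw [hgrid]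
      exact hF
    all_goals dsimp only; omega
  refine ⟨T, insert (0, 1) (((T.erase (-k, y₀)).erase (t - k, 0)).image (· + (0, 1))), ?_,
    fun c hc => bounds_of_mem_cornerPart hc, fun z hz1 hz2 hz => ?_⟩
  · have e1 : (T.erase (-k, y₀)).card + 1 = T.card :=
      Finset.card_erase_add_one (left_mem_cornerPart hk h1 hy hA)
    have e2 := card_image_erase_add_one_le hc (· + (0, 1))
    have e3 := Finset.card_insert_le ((0, 1) : ℤ × ℤ)
      (((T.erase (-k, y₀)).erase (t - k, 0)).image (· + (0, 1)))
    omega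
  · rcases covered_by_shift_up hk hy hA hz1 hz2 hz with ⟨c, hc, hd⟩ | ⟨hz0, hC, hF⟩
    · by_cases h : c = (t - k, 0)
      · refine ⟨_, Finset.mem_insert_self _ _, ?_⟩
        rw [h] at hd
        rw [taxi_le_iff] at hd ⊢
        simp only [Prod.fst_add, Prod.snd_add] at hd ⊢
        omega
      · exact ⟨_, Finset.mem_insert_of_mem
          (Finset.mem_image_of_mem _ (Finset.mem_erase.2 ⟨h, hc⟩)), hd⟩
    · refine ⟨_, Finset.mem_insert_self _ _, ?_⟩
      -- the other centres in the row `-k - 1` lie beyond the level line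
      have hle : z.1 ≤ t := by
        refine le_of_dvd_sub_of_lt (hX.dvd_sub_fst hC) ?_
        simp only [gridForm] at hF
        by_contra! h
        nlinarith
      rw [taxi_le_iff]
      dsimp only
      omega

/-- The saving when a centre lies in the bottom row of the corner square: it covers no point of the
quadrant. -/
theorem exists_cornerSaving_of_corner {k l x : ℤ} (hk : 1 ≤ k) (hx : -k ≤ x) (hx0 : x < 0)
    (hX : InCode k l (x, -k)) : ∃ T M, CornerSaving k l T M := by
  have hpk : ballSize k = 2 * k ^ 2 + 2 * k + 1 := rfl
  refine ⟨{(x, -k)}, ∅, by simp, ?_, ?_⟩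
  · intro c hc
    rw [Finset.mem_singleton.1 hc]
    refine ⟨hX, ?_, ?_, ?_, ?_⟩ <;> dsimp only <;> nlinarith
  · rintro z hz1 hz2 ⟨c, hc, hd⟩
    rw [Finset.mem_singleton.1 hc] at hd
    rw [taxi_le_iff] at hd
    dsimp only at hd
    omega

/-- The saving by a translation along `(1, -1)`: the centre `(x, -k)` leaves the enlarged
quadrant, and no centre that covers a point of the quadrant enters it from the left. -/
theorem exists_cornerSaving_of_slide {k l x : ℤ} (hk : 1 ≤ k) (hx : 0 ≤ x)
    (hX : InCode k l (x, -k)) (hF : gridForm k (x, -k) ≤ k * (ballSize k - k - 1))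
    (hno : ∀ y, 1 ≤ y → InCode k l (-k - 1, y) → gridForm k (x, -k) < gridForm k (-k - 1, y)) :
    ∃ T M, CornerSaving k l T M := by
  set T := cornerPart k l (gridForm k (x, -k)) with hT
  have hB : (x, -k) ∈ T := (mem_cornerPart hk hF).2 ⟨hX, le_rfl, by dsimp only; omega, le_rfl⟩
  refine ⟨T, (T.erase (x, -k)).image (· + (1, -1)), card_image_erase_add_one_le hB _,
    fun c hc => bounds_of_mem_cornerPart hc, ?_⟩
  rintro z hz1 hz2 ⟨c, hc, hzc⟩
  obtain ⟨-, hcF, -, -⟩ := (mem_cornerPart hk hF).1 hc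
  obtain ⟨c', hc'C, hc'F, hd⟩ := exists_shifted_center (w := (1, -1)) hk hX
    (by simp only [gridForm]; linarith) hcF hzc
  rw [taxi_le_iff] at hd
  simp only [Prod.fst_sub, Prod.snd_sub] at hd
  have hge : -k ≤ c'.1 := by
    by_contra! hlt
    have e : c' = (-k - 1, c'.2) := Prod.ext (by dsimp only; omega) rfl
    have := hno c'.2 (by omega) (e ▸ hc'C)
    rw [← e] at this
    omega
  refine ⟨c' + (1, -1), Finset.mem_image_of_mem _ (Finset.mem_erase.2 ⟨?_, ?_⟩), ?_⟩
  · rintro rfl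
    dsimp only at hd
    omega
  · exact (mem_cornerPart hk hF).2 ⟨hc'C, hc'F, hge, by omega⟩
  · rw [taxi_le_iff]
    simp only [Prod.fst_add, Prod.snd_add]
    omega

/-- Every code admits a saving at the corner of the quadrant. With `(-k, y₀)` a centre and
`y₀ = (k + 1) q + s`, the point `(k q + (2 k + 1) s, -k - 1)` is a centre, and the residue of its
abscissa decides which of the constructions applies. -/
theorem exists_cornerSaving {k : ℤ} (hk : 1 ≤ k) (l : ℤ) : ∃ T M, CornerSaving k l T M := by
  have hpk : ballSize k = 2 * k ^ 2 + 2 * k + 1 := rfl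
  obtain ⟨y₀, h1, hy, hA⟩ := exists_inCode_left hk l
  obtain ⟨q, s, hqs, hs0, hsk⟩ : ∃ q s, y₀ = (k + 1) * q + s ∧ 0 ≤ s ∧ s ≤ k := by
    refine ⟨y₀ / (k + 1), y₀ % (k + 1), ?_, Int.emod_nonneg _ (by omega), ?_⟩
    · have := Int.emod_add_mul_ediv y₀ (k + 1)
      omega
    · have := Int.emod_lt_of_pos y₀ (show 0 < k + 1 by omega)
      omega
  have hq0 : 0 ≤ q := by
    by_contra! h
    nlinarith
  have hq : q ≤ 2 * k := by
    by_contra! h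
    nlinarith
  rcases hs0.eq_or_lt with rfl | hs
  · rw [add_zero] at hqs
    subst hqs
    refine exists_cornerSaving_of_entry_on_line hk ?_ hq hA
    by_contra! h
    nlinarith
  have hX : InCode k l (k * q + (2 * k + 1) * s, -k - 1) := by
    have := hA.add_of_dvd (v := (k * q + (2 * k + 1) * s + k, -k - 1 - y₀))
      ⟨s, by simp only [gridForm, ballSize, hqs]; ring⟩
    convert this using 1
    ext <;> simp only [Prod.fst_add, Prod.snd_add] <;> ring
  have hqk : 0 ≤ k * q := by positivity
  rcases lt_or_ge (k * q + (2 * k + 1) * s) (ballSize k) with hlt | hge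
  · refine exists_cornerSaving_of_no_entry hk h1 hy hA fun x hx hC => ?_
    have := le_of_dvd_sub_of_lt (hC.dvd_sub_fst hX) (by omega)
    simp only [gridForm, hqs]
    nlinarith
  obtain ⟨t, ht⟩ : ∃ t, t = k * q + (2 * k + 1) * s - ballSize k := ⟨_, rfl⟩
  have hXt : InCode k l (t, -k - 1) := by
    have := hX.add_of_dvd (v := (-ballSize k, 0))
      ⟨-(k + 1), by simp only [gridForm]; ring⟩
    convert this using 1
    ext <;> simp only [Prod.fst_add, Prod.snd_add, ht] <;> ring
  have hFt : gridForm k (t, -k - 1) = k * (y₀ - k - 1) - ballSize k * (k + 1 - s) := by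
    simp only [gridForm, ht, hqs, ballSize]; ring
  have hp := ballSize_pos hk
  rcases lt_or_ge t k with htk | htk
  · exact exists_cornerSaving_of_entry_lt hk h1 hy hA (by omega) htk hXt (by nlinarith)
  have hB : InCode k l (t - (2 * k + 1), -k) := by
    have := hXt.add_of_dvd (v := (-(2 * k + 1), 1))
      ⟨-1, by simp only [gridForm, ballSize]; ring⟩
    convert this using 1
    ext <;> simp only [Prod.fst_add, Prod.snd_add] <;> ring
  rcases lt_or_ge t (2 * k + 1) with ht2 | ht2
  · refine exists_cornerSaving_of_corner hk ?_ (by omega) hB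
    -- `t = k` would put `(-k, k + 1)` into the code, and then `s = 0`
    by_contra! h
    have htk' : t = k := by omega
    have hA' : InCode k l (-k, k + 1) := by
      have : gridForm k (-k, k + 1) = gridForm k (t, -k - 1) := by
        simp only [gridForm, htk']; ring
      rw [InCode, this]
      exact hXt
    have e1 := le_of_dvd_sub_of_lt (hA.dvd_sub_snd hA') (by nlinarith)
    have e2 := le_of_dvd_sub_of_lt (hA'.dvd_sub_snd hA) (by omega)
    have e3 : y₀ = k + 1 := by omega
    have hq1 : q < 1 := by
      by_contra! h
      nlinarith
    have : q = 0 := by omega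
    subst this
    omega
  · have hFB : gridForm k (t - (2 * k + 1), -k) =
        k * (y₀ - k - 1) - ballSize k * (k + 2 - s) := by
      have : gridForm k (t - (2 * k + 1), -k) = gridForm k (t, -k - 1) - ballSize k := by
        simp only [gridForm, ballSize]; ring
      rw [this, hFt]; ring
    refine exists_cornerSaving_of_slide hk (by omega) hB (by rw [hFB]; nlinarith) ?_
    intro y hy1 hC
    have hC' : InCode k l (-k - 1, y₀ - (2 * k + 1)) := by
      have := hA.add_of_dvd (v := (-1, -(2 * k + 1)))
        ⟨-1, by simp only [gridForm, ballSize]; ring⟩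
      convert this using 1
      ext <;> simp only [Prod.fst_add, Prod.snd_add] <;> ring
    have hle := le_of_dvd_sub_of_lt (hC.dvd_sub_snd hC') (by omega)
    rw [hFB]
    have e : gridForm k (-k - 1, y) = k * (y₀ - k - 1) - ballSize k +
        k * (y - (y₀ - (2 * k + 1))) := by
      simp only [gridForm, ballSize]; ring
    rw [e]
    nlinarith

/-! ### The four corners of a rectangle -/

/-- The saving at a corner, transported by an isometry `g` of the plane that respects the codes. -/
theorem exists_saving_map {k l l' : ℤ} (hk : 1 ≤ k) (g : ℤ × ℤ → ℤ × ℤ)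
    (hg : ∀ a b, taxi (g a) (g b) = taxi a b) (hl : ∀ c, InCode k l' c → InCode k l (g c)) :
    ∃ T M : Finset (ℤ × ℤ), M.card + 1 ≤ T.card ∧
      (∀ c ∈ T, InCode k l c ∧ ∃ b : ℤ × ℤ, c = g b ∧
        -k ≤ b.1 ∧ b.1 < ballSize k ∧ -k ≤ b.2 ∧ b.2 ≤ ballSize k) ∧
      ∀ z, (∃ a : ℤ × ℤ, z = g a ∧ 0 ≤ a.1 ∧ 0 ≤ a.2) → (∃ c ∈ T, taxi z c ≤ k) →
        ∃ c ∈ M, taxi z c ≤ k := by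
  obtain ⟨T, M, hcard, hT, hcov⟩ := exists_cornerSaving hk l'
  have hinj : Function.Injective g := by
    intro a b hab
    have h : taxi a b ≤ 0 := by
      rw [← hg, hab]
      simp [taxi]
    rw [taxi_le_iff] at h
    exact Prod.ext (by omega) (by omega)
  refine ⟨T.image g, M.image g, ?_, ?_, ?_⟩
  · rw [Finset.card_image_of_injective T hinj]
    exact (Nat.add_le_add_right Finset.card_image_le 1).trans hcard
  · intro c hc
    obtain ⟨b, hb, rfl⟩ := Finset.mem_image.1 hc
    exact ⟨hl b (hT b hb).1, b, rfl, (hT b hb).2⟩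
  · rintro z ⟨a, rfl, h1, h2⟩ ⟨c, hc, hd⟩
    obtain ⟨b, hb, rfl⟩ := Finset.mem_image.1 hc
    rw [hg] at hd
    obtain ⟨b', hb', hd'⟩ := hcov a h1 h2 ⟨b, hb, hd⟩
    exact ⟨g b', Finset.mem_image_of_mem g hb', by rwa [hg]⟩

/-- A quarter turn maps codes to codes: it multiplies the form by `2 k + 1`, a square root of `-1`
modulo `2 k ^ 2 + 2 k + 1`. -/
theorem InCode.rotate {k l a b : ℤ} {c : ℤ × ℤ}
    (hc : InCode k (-(2 * k + 1) * (l - gridForm k (a, b))) c) :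
    InCode k l (a - c.2, b + c.1) := by
  obtain ⟨i, hi⟩ := hc
  refine ⟨-2 * (l - gridForm k (a, b)) + (2 * k + 1) * i - (c.1 + c.2), ?_⟩
  simp only [gridForm, ballSize] at *
  linear_combination (2 * k + 1) * hi

theorem InCode.rotate_symm {k l a b : ℤ} {c : ℤ × ℤ}
    (hc : InCode k ((2 * k + 1) * (l - gridForm k (a, b))) c) :
    InCode k l (a + c.2, b - c.1) := by
  obtain ⟨i, hi⟩ := hc
  refine ⟨-2 * (l - gridForm k (a, b)) - (2 * k + 1) * i + (c.1 + c.2), ?_⟩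
  simp only [gridForm, ballSize] at *
  linear_combination -(2 * k + 1) * hi

theorem InCode.sub {k l a b : ℤ} {c : ℤ × ℤ} (hc : InCode k (gridForm k (a, b) - l) c) :
    InCode k l (a - c.1, b - c.2) := by
  obtain ⟨i, hi⟩ := hc
  refine ⟨-i, ?_⟩
  simp only [gridForm] at *
  linear_combination -hi

open Classical in
/-- By averaging, some code has at most its share of the centres in a finite set. -/
theorem exists_card_filter_inCode_mul_le {k : ℤ} (hk : 1 ≤ k) (E : Finset (ℤ × ℤ)) :
    ∃ l, ((E.filter (InCode k l)).card : ℤ) * ballSize k ≤ E.card := by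
  have hp := ballSize_pos hk
  obtain ⟨p, hpp⟩ : ∃ p : ℕ, (p : ℤ) = ballSize k := ⟨_, Int.toNat_of_nonneg hp.le⟩
  have hp' : 0 < p := by omega
  have hcard : (Finset.Ico 0 (ballSize k)).card = p := by
    rw [Int.card_Ico]
    omega
  obtain ⟨l, hl, hlt⟩ := Finset.exists_card_fiber_lt_of_card_lt_mul (s := E)
    (t := Finset.Ico 0 (ballSize k)) (f := fun z => gridForm k z % ballSize k)
    (n := E.card / p + 1) (by rw [hcard]; exact Nat.lt_mul_div_succ _ hp')
  refine ⟨l, ?_⟩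
  have hle : (E.filter (InCode k l)).card ≤ E.card / p := by
    refine le_trans (Finset.card_le_card fun z hz => ?_) (Nat.lt_succ_iff.1 hlt)
    obtain ⟨hzE, hz⟩ := Finset.mem_filter.1 hz
    obtain ⟨h0, h1⟩ := Finset.mem_Ico.1 hl
    refine Finset.mem_filter.2 ⟨hzE, ?_⟩
    rw [Int.emod_eq_emod_iff_emod_sub_eq_zero.2 (Int.emod_eq_zero_of_dvd hz),
      Int.emod_eq_of_lt h0 h1]
  rw [← hpp]
  exact_mod_cast (Nat.mul_le_mul_right p hle).trans (Nat.div_mul_le_self _ _)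

/-- The rectangle `[0, m) × [0, n)` is covered by balls of radius `k`, with centres anywhere in the
plane, of which there are at least four fewer than the average number of centres of a code in the
rectangle enlarged by `k`: the four corner savings concern disjoint sets of centres. -/
theorem exists_cover_rectangle {k m n : ℤ} (hk : 1 ≤ k) (hm : 2 * ballSize k < m)
    (hn : 2 * ballSize k < n) : ∃ S : Finset (ℤ × ℤ),
      ((S.card : ℤ) + 4) * ballSize k ≤ (m + 2 * k) * (n + 2 * k) ∧
      ∀ z : ℤ × ℤ, 0 ≤ z.1 → z.1 < m → 0 ≤ z.2 → z.2 < n → ∃ c ∈ S, taxi z c ≤ k := by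
  classical
  have hkp : 2 * k < ballSize k := by unfold ballSize; nlinarith
  set E := Finset.Icc (-k) (m - 1 + k) ×ˢ Finset.Icc (-k) (n - 1 + k) with hE
  have hEcard : (E.card : ℤ) = (m + 2 * k) * (n + 2 * k) := by
    rw [hE, Finset.card_product, Int.card_Icc, Int.card_Icc]
    push_cast
    rw [Int.toNat_of_nonneg (by omega), Int.toNat_of_nonneg (by omega)]
    ring
  obtain ⟨l, hl⟩ := exists_card_filter_inCode_mul_le hk E
  rw [hEcard] at hl
  set C := E.filter (InCode k l) with hC
  have hCmem : ∀ c : ℤ × ℤ, c ∈ C ↔ ((-k ≤ c.1 ∧ c.1 ≤ m - 1 + k) ∧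
      (-k ≤ c.2 ∧ c.2 ≤ n - 1 + k)) ∧ InCode k l c := by
    intro c
    simp [hC, hE]
  have habs : ∀ a b c : ℤ, |a - b - (a - c)| = |b - c| := by
    intro a b c
    rw [abs_sub_comm b c]
    congr 1
    ring
  obtain ⟨T₁, M₁, hc₁, hT₁, hcov₁⟩ := exists_saving_map hk id (fun _ _ => rfl)
    (fun c (hc : InCode k l c) => hc)
  obtain ⟨T₂, M₂, hc₂, hT₂, hcov₂⟩ := exists_saving_map (l := l) hk
    (fun c => (m - 1 - c.2, 0 + c.1))
    (fun a b => by simp only [taxi, habs, add_sub_add_left_eq_sub]; ring)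
    (fun c hc => hc.rotate)
  obtain ⟨T₃, M₃, hc₃, hT₃, hcov₃⟩ := exists_saving_map (l := l) hk
    (fun c => (m - 1 - c.1, n - 1 - c.2)) (fun a b => by simp only [taxi, habs])
    (fun c hc => hc.sub)
  obtain ⟨T₄, M₄, hc₄, hT₄, hcov₄⟩ := exists_saving_map (l := l) hk
    (fun c => (0 + c.2, n - 1 - c.1))
    (fun a b => by simp only [taxi, habs, add_sub_add_left_eq_sub]; ring)
    (fun c hc => hc.rotate_symm)
  have b₁ : ∀ c ∈ T₁, InCode k l c ∧
      -k ≤ c.1 ∧ c.1 < ballSize k ∧ -k ≤ c.2 ∧ c.2 ≤ ballSize k := by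
    intro c hc
    obtain ⟨h, b, rfl, hb⟩ := hT₁ c hc
    exact ⟨h, hb⟩
  have b₂ : ∀ c ∈ T₂, InCode k l c ∧ m - 1 - ballSize k ≤ c.1 ∧ c.1 ≤ m - 1 + k ∧
      -k ≤ c.2 ∧ c.2 < ballSize k := by
    intro c hc
    obtain ⟨h, b, rfl, hb⟩ := hT₂ c hc
    exact ⟨h, by dsimp only; omega⟩
  have b₃ : ∀ c ∈ T₃, InCode k l c ∧ m - 1 - ballSize k < c.1 ∧ c.1 ≤ m - 1 + k ∧
      n - 1 - ballSize k ≤ c.2 ∧ c.2 ≤ n - 1 + k := by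
    intro c hc
    obtain ⟨h, b, rfl, hb⟩ := hT₃ c hc
    exact ⟨h, by dsimp only; omega⟩
  have b₄ : ∀ c ∈ T₄, InCode k l c ∧ -k ≤ c.1 ∧ c.1 ≤ ballSize k ∧
      n - 1 - ballSize k < c.2 ∧ c.2 ≤ n - 1 + k := by
    intro c hc
    obtain ⟨h, b, rfl, hb⟩ := hT₄ c hc
    exact ⟨h, by dsimp only; omega⟩
  have hd₂ : Disjoint T₁ T₂ := Finset.disjoint_left.2 fun c h h' => by
    have := b₁ c h
    have := b₂ c h'
    omega
  have hd₃ : Disjoint (T₁ ∪ T₂) T₃ := Finset.disjoint_left.2 fun c h h' => by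
    have := b₃ c h'
    rcases Finset.mem_union.1 h with h | h
    · have := b₁ c h
      omega
    · have := b₂ c h
      omega
  have hd₄ : Disjoint (T₁ ∪ T₂ ∪ T₃) T₄ := Finset.disjoint_left.2 fun c h h' => by
    have := b₄ c h'
    rcases Finset.mem_union.1 h with h | h
    · rcases Finset.mem_union.1 h with h | h
      · have := b₁ c h
        omega
      · have := b₂ c h
        omega
    · have := b₃ c h
      omega
  have hTC : T₁ ∪ T₂ ∪ T₃ ∪ T₄ ⊆ C := by
    intro c hc
    rw [hCmem]
    simp only [Finset.mem_union] at hc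
    rcases hc with ((h | h) | h) | h
    · obtain ⟨h, _⟩ := b₁ c h
      exact ⟨by omega, h⟩
    · obtain ⟨h, _⟩ := b₂ c h
      exact ⟨by omega, h⟩
    · obtain ⟨h, _⟩ := b₃ c h
      exact ⟨by omega, h⟩
    · obtain ⟨h, _⟩ := b₄ c h
      exact ⟨by omega, h⟩
  refine ⟨(C \ (T₁ ∪ T₂ ∪ T₃ ∪ T₄)) ∪ (M₁ ∪ M₂ ∪ M₃ ∪ M₄), ?_, ?_⟩
  · have e1 := Finset.card_union_of_disjoint hd₂
    have e2 := Finset.card_union_of_disjoint hd₃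
    have e3 := Finset.card_union_of_disjoint hd₄
    have e4 := Finset.card_sdiff_add_card_eq_card hTC
    have e5 := Finset.card_union_le M₁ M₂
    have e6 := Finset.card_union_le (M₁ ∪ M₂) M₃
    have e7 := Finset.card_union_le (M₁ ∪ M₂ ∪ M₃) M₄
    have e8 := Finset.card_union_le (C \ (T₁ ∪ T₂ ∪ T₃ ∪ T₄)) (M₁ ∪ M₂ ∪ M₃ ∪ M₄)
    refine le_trans (mul_le_mul_of_nonneg_right ?_ (ballSize_pos hk).le) hl
    omega
  · intro z hz1 hzm hz2 hzn
    obtain ⟨c, hc, hd⟩ := exists_inCode_taxi_le hk l z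
    have hcC : c ∈ C := by
      rw [hCmem]
      rw [taxi_le_iff] at hd
      exact ⟨by omega, hc⟩
    by_cases hcT : c ∈ T₁ ∪ T₂ ∪ T₃ ∪ T₄
    · simp only [Finset.mem_union] at hcT
      rcases hcT with ((h | h) | h) | h
      · obtain ⟨c', h', hd'⟩ := hcov₁ z ⟨z, rfl, hz1, hz2⟩ ⟨c, h, hd⟩
        exact ⟨c', by simp [h'], hd'⟩
      · obtain ⟨c', h', hd'⟩ := hcov₂ z ⟨(z.2, m - 1 - z.1), by ext <;> simp, hz2, by
          dsimp only; omega⟩ ⟨c, h, hd⟩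
        exact ⟨c', by simp [h'], hd'⟩
      · obtain ⟨c', h', hd'⟩ := hcov₃ z ⟨(m - 1 - z.1, n - 1 - z.2), by ext <;> simp, by
          dsimp only; omega, by dsimp only; omega⟩ ⟨c, h, hd⟩
        exact ⟨c', by simp [h'], hd'⟩
      · obtain ⟨c', h', hd'⟩ := hcov₄ z ⟨(n - 1 - z.2, z.1), by ext <;> simp, by
          dsimp only; omega, hz1⟩ ⟨c, h, hd⟩
        exact ⟨c', by simp [h'], hd'⟩
    · exact ⟨c, Finset.mem_union_left _ (Finset.mem_sdiff.2 ⟨hcC, hcT⟩), hd⟩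

/-! ### Domination of the grid graph -/

theorem edist_pathGraph_le {n : ℕ} (a b : Fin n) :
    (SimpleGraph.pathGraph n).edist a b ≤ ((((a : ℕ) : ℤ) - (b : ℕ)).natAbs : ℕ∞) := by
  wlog hab : a ≤ b generalizing a b
  · rw [SimpleGraph.edist_comm, ← Int.natAbs_neg, neg_sub]
    exact this b a (le_of_not_ge hab)
  obtain ⟨d, hd⟩ := Nat.exists_eq_add_of_le (Fin.le_def.1 hab)
  have : (((a : ℕ) : ℤ) - (b : ℕ)).natAbs = d := by omega
  rw [this]
  clear this hab
  induction d generalizing b with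
  | zero =>
    have : a = b := Fin.ext (by omega)
    simp [this]
  | succ d ih =>
    have hlt : (a : ℕ) + d < n := by omega
    have hadj : (SimpleGraph.pathGraph n).Adj ⟨a + d, hlt⟩ b :=
      SimpleGraph.pathGraph_adj.2 (Or.inl (by dsimp only; omega))
    calc (SimpleGraph.pathGraph n).edist a b
        ≤ _ := SimpleGraph.edist_triangle (v := ⟨a + d, hlt⟩)
      _ ≤ (d : ℕ∞) + 1 := add_le_add (ih _ rfl) (SimpleGraph.edist_eq_one_iff_adj.2 hadj).le
      _ = ((d + 1 : ℕ) : ℕ∞) := by push_cast; rfl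

theorem edist_gridGraph_le_of_taxi_le {m n k : ℕ} {a b : Fin m × Fin n}
    (h : taxi ((a.1 : ℕ), (a.2 : ℕ)) ((b.1 : ℕ), (b.2 : ℕ)) ≤ k) :
    (gridGraph m n).edist a b ≤ (k : ℕ∞) := by
  rw [gridGraph, SimpleGraph.edist_boxProd]
  refine (add_le_add (edist_pathGraph_le a.1 b.1) (edist_pathGraph_le a.2 b.2)).trans ?_
  rw [taxi_le_iff] at h
  dsimp only at h
  have : (((a.1 : ℕ) : ℤ) - (b.1 : ℕ)).natAbs + (((a.2 : ℕ) : ℤ) - (b.2 : ℕ)).natAbs ≤ k := by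
    omega
  exact_mod_cast this

/-- The grid point nearest to a point of `ℤ²`. -/
def clampGrid {m n : ℕ} (hm : 0 < m) (hn : 0 < n) (c : ℤ × ℤ) : Fin m × Fin n :=
  (⟨min c.1.toNat (m - 1), by omega⟩, ⟨min c.2.toNat (n - 1), by omega⟩)

/-- Centres outside the grid may be replaced by their nearest grid points, since these are no
farther from any grid point. -/
theorem distDominationNumber_gridGraph_le {m n k : ℕ} (hm : 0 < m) (hn : 0 < n)
    (S : Finset (ℤ × ℤ)) (hS : ∀ z : ℤ × ℤ, 0 ≤ z.1 → z.1 < m → 0 ≤ z.2 → z.2 < n →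
      ∃ c ∈ S, taxi z c ≤ k) : distDominationNumber (gridGraph m n) k ≤ S.card := by
  classical
  refine le_trans (Nat.sInf_le ⟨S.image (clampGrid hm hn), ?_, rfl⟩) Finset.card_image_le
  intro v
  obtain ⟨c, hc, hd⟩ := hS ((v.1 : ℕ), (v.2 : ℕ)) (by simp) (by simp) (by simp) (by simp)
  refine Or.inr ⟨clampGrid hm hn c, Finset.mem_image_of_mem _ hc,
    edist_gridGraph_le_of_taxi_le ?_⟩
  have h1 := v.1.isLt
  have h2 := v.2.isLt
  rw [taxi_le_iff] at hd ⊢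
  simp only [clampGrid] at hd ⊢
  omega

theorem mainTheorem1 (k m n p : ℕ) (hk : 1 ≤ k) (hp : p = 2 * k ^ 2 + 2 * k + 1)
    (hm : 2 * p < m) (hn : 2 * p < n) :
    (distDominationNumber (gridGraph m n) k : ℤ)
        ≤ ⌊(((m : ℝ) + 2 * k) * ((n : ℝ) + 2 * k)) / (p : ℝ)⌋ - 4 ∧
      ⌊(((m : ℝ) + 2 * k) * ((n : ℝ) + 2 * k)) / (p : ℝ)⌋ - 4
        < ⌈(((m : ℝ) + 2 * k) * ((n : ℝ) + 2 * k)) / (p : ℝ) + (p : ℝ) / 4⌉ := by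
  have hpb : ballSize k = p := by rw [hp, ballSize]; push_cast; ring
  have hp0 : (0 : ℝ) < p := by
    rw [hp]
    positivity
  constructor
  · obtain ⟨S, hcard, hS⟩ := exists_cover_rectangle (k := k) (m := m) (n := n)
      (by exact_mod_cast hk) (by rw [hpb]; exact_mod_cast hm) (by rw [hpb]; exact_mod_cast hn)
    have hdom := distDominationNumber_gridGraph_le (k := k) (by omega) (by omega) S hS
    rw [hpb] at hcard
    have hfloor : (S.card : ℤ) + 4 ≤ ⌊(((m : ℝ) + 2 * k) * ((n : ℝ) + 2 * k)) / (p : ℝ)⌋ := by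
      rw [Int.le_floor, le_div_iff₀ hp0]
      exact_mod_cast hcard
    omega
  · have h1 := Int.floor_le_ceil ((((m : ℝ) + 2 * k) * ((n : ℝ) + 2 * k)) / (p : ℝ))
    have h2 : ⌈(((m : ℝ) + 2 * k) * ((n : ℝ) + 2 * k)) / (p : ℝ)⌉ ≤
        ⌈(((m : ℝ) + 2 * k) * ((n : ℝ) + 2 * k)) / (p : ℝ) + (p : ℝ) / 4⌉ :=
      Int.ceil_le_ceil (by linarith)
    omega
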